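/- Let $S_\infty$ be the group of permutations of $\{1,2,\dots\}$ fixing all but finitely many elements, $s_i=(i\;i{+}1)$, $S_m=\{w\in S_\infty : w(i)=i \text{ for all } i>m\}$, and let $\ell(w)$ be the number of inversions of $w$. A reduced word of $w$ is a sequence $(i_1,\dots,i_{\ell(w)})$ with $w=s_{i_1}\cdots s_{i_{\ell(w)}}$. On $\mathbb Z[\mathbf t][\mathbf x]$, with $\mathbf x=(x_1,x_2,\dots)$ and $\mathbf t=(t_1,t_2,\dots)$, let $\partial_i f=\frac{f-s_i\cdot f}{x_i-x_{i+1}}$, where $s_i$ swaps $x_i$ and $x_{i+1}$. The double Schubert polynomials $\mathfrak S_w(\mathbf x;\mathbf t)$, $w\in S_\infty$, are the unique family of homogeneous polynomials in $\mathbb Z[\mathbf t][\mathbf x]$ such that $\mathfrak S_w(\mathbf t;\mathbf t)=\delta_{w,\mathrm{id}}$ and, for all $i\ge 1$, $\partial_i\mathfrak S_w=\mathfrak S_{ws_i}$ if $\ell(ws_i)<\ell(w)$ and $\partial_i\mathfrak S_w=0$ otherwise. For $n\ge 0$ let $\widetilde\omega_{[n]}=\omega^{(1)}_{[n]}\omega^{(2)}_{[n]}\cdots\omega^{(n)}_{[n]}$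 be the concatenation of the words $$\omega^{(k)}_{[n]}=\bigl(n^{(k)},(n-1)^{(k)},\dots,(k+1)^{(k)},k^{(k)},\overline{k+1}^{(k)},\dots,\overline{n-1}^{(k)},\overline{n}^{(k)}\bigr),$$ where the letters $j^{(k)}$ and $\overline{j}^{(k)}$ both have value $j$, and weights $\operatorname{wt}(j^{(k)})=x_k-t_j$ and $\operatorname{wt}(\overline{j}^{(k)})=t_j-t_k$. For $w\in S_\infty$ let $\mathcal R(\widetilde\omega_{[n]};w)$ be the set of subwords $\pi$ of $\widetilde\omega_{[n]}$ (one for each choice of a set of positions) whose sequence of values is a reduced word of $w$, and let $\operatorname{wt}(\pi)$ be the product of the weights of the letters of $\pi$. Theorem. The family of double Schubert polynomials exists and is unique, and for every $n\ge 0$ and every $w\in S_{n+1}$, $$\mathfrak S_w(\mathbf x;\mathbf t)=\sum_{\pi\in\mathcal R(\widetilde\omega_{[n]};w)}\operatorname{wt}(\pi).$$ -/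

import Mathlib

/-!
Indexing convention: the positive integers `1, 2, 3, …` are represented by the natural
numbers `0, 1, 2, …`.  So the natural number `i` stands for the usual index `i + 1`, both for
points permuted, for simple transpositions, for variables and for letters of words.
-/

namespace VineModel

/-- The polynomial ring `ℤ[t][x]` in two infinite families of variables. -/
abbrev Poly : Type := MvPolynomial (ℕ ⊕ ℕ) ℤ

/-- The variable `x_i`. -/
noncomputable def xv (i : ℕ) : Poly := MvPolynomial.X (Sum.inl i)

/-- The variable `t_i`. -/
noncomputable def tv (i : ℕ) : Poly := MvPolynomial.X (Sum.inr i)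

/-- `S_∞`: the permutations that fix all but finitely many elements. -/
def SInf : Subgroup (Equiv.Perm ℕ) where
  carrier := {w | {i | w i ≠ i}.Finite}
  one_mem' := by simp
  mul_mem' := by
    intro u v hu hv
    refine (Set.Finite.union hu hv).subset ?_
    intro i hi
    by_contra h
    simp only [Set.mem_union, Set.mem_ofPred_eq, not_or, not_not] at h
    exact hi (by rw [Equiv.Perm.mul_apply, h.2, h.1])
  inv_mem' := by
    intro w hw
    refine Set.Finite.subset hw ?_
    intro i hi h
    exact hi (by rw [Equiv.Perm.inv_eq_iff_eq]; exact h.symm)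

/-- `S_n`, as the subgroup of `S_∞` of the permutations that fix every element after the first
`n` elements (that is, every natural number `≥ n`). -/
def symmetricSubgroup (n : ℕ) : Subgroup SInf where
  carrier := {w | ∀ i, n ≤ i → w.1 i = i}
  one_mem' := by intro i _; rfl
  mul_mem' := by
    intro u v hu hv i hi
    change u.1 (v.1 i) = i
    rw [hv i hi, hu i hi]
  inv_mem' := by
    intro w hw i hi
    change (w.1)⁻¹ i = i
    rw [Equiv.Perm.inv_eq_iff_eq]
    exact (hw i hi).symm

/-- The adjacent transposition `s_i = (i, i+1)`. -/
def simpleTransposition (i : ℕ) : SInf :=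
  ⟨Equiv.swap i (i + 1), by
    refine (Set.toFinite ({i, i + 1} : Set ℕ)).subset ?_
    intro j hj
    by_contra h
    simp only [Set.mem_insert_iff, Set.mem_singleton_iff, not_or] at h
    exact hj (Equiv.swap_apply_of_ne_of_ne h.1 h.2)⟩

/-- The length `ℓ(w)`: the number of inversions of `w`. -/
noncomputable def length (w : SInf) : ℕ :=
  {p : ℕ × ℕ | p.1 < p.2 ∧ w.1 p.2 < w.1 p.1}.ncard

/-- The set of reduced words of `w`: words `(i_1, …, i_ℓ)` with `ℓ = ℓ(w)` and
`w = s_{i_1} ⋯ s_{i_ℓ}`. -/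
def reducedWords (w : SInf) : Set (List ℕ) :=
  {l | (l.map simpleTransposition).prod = w ∧ l.length = length w}

/-- The action of `S_∞` on `ℤ[t][x]` by permuting the `x`-variables, `x_j ↦ x_{w(j)}`. -/
noncomputable def act (w : SInf) (f : Poly) : Poly :=
  MvPolynomial.rename (Sum.map w.1 id) f

theorem exists_dividedDifference (i : ℕ) (f : Poly) :
    ∃ g : Poly, (xv i - xv (i + 1)) * g = f - act (simpleTransposition i) f := by
  suffices h : (xv i - xv (i + 1)) ∣ f - act (simpleTransposition i) f by
    obtain ⟨g, hg⟩ := h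
    exact ⟨g, hg.symm⟩
  have key : ∀ v : ℕ ⊕ ℕ, (xv i - xv (i + 1)) ∣
      (MvPolynomial.X v : Poly) - act (simpleTransposition i) (MvPolynomial.X v) := by
    rintro (j | j)
    · have hj : act (simpleTransposition i) (MvPolynomial.X (Sum.inl j)) =
          xv (Equiv.swap i (i + 1) j) := by
        simp [act, xv, simpleTransposition]
      rw [hj]
      rcases eq_or_ne j i with rfl | h1
      · rw [Equiv.swap_apply_left]
        exact dvd_rfl
      · rcases eq_or_ne j (i + 1) with rfl | h2
        · rw [Equiv.swap_apply_right]
          exact ⟨-1, by simp [xv]⟩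
        · rw [Equiv.swap_apply_of_ne_of_ne h1 h2]
          simp [xv]
    · simp [act]
  induction f using MvPolynomial.induction_on with
  | C a => simp [act]
  | add p q hp hq =>
    have : p + q - act (simpleTransposition i) (p + q) =
        (p - act (simpleTransposition i) p) + (q - act (simpleTransposition i) q) := by
      simp only [act, map_add]; ring
    rw [this]
    exact dvd_add hp hq
  | mul_X p v hp =>
    have : p * MvPolynomial.X v - act (simpleTransposition i) (p * MvPolynomial.X v) =
        (p - act (simpleTransposition i) p) * MvPolynomial.X v +
        act (simpleTransposition i) p *
          (MvPolynomial.X v - act (simpleTransposition i) (MvPolynomial.X v)) := by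
      simp only [act, map_mul]; ring
    rw [this]
    exact dvd_add (hp.mul_right _) ((key v).mul_left _)

/-- The divided difference `∂_i f = (f - s_i · f) / (x_i - x_{i+1})`. -/
noncomputable def dividedDifference (i : ℕ) (f : Poly) : Poly :=
  Classical.choose (exists_dividedDifference i f)

/-- The defining property of `∂_i f`; it determines `∂_i f` since `ℤ[t][x]` is a domain. -/
theorem dividedDifference_spec (i : ℕ) (f : Poly) :
    (xv i - xv (i + 1)) * dividedDifference i f = f - act (simpleTransposition i) f :=
  Classical.choose_spec (exists_dividedDifference i f)

/-- The specialization `f(x;t) ↦ f(t;t)`. -/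
noncomputable def evalAtT (f : Poly) : Poly :=
  MvPolynomial.aeval (Sum.elim tv tv) f

open scoped Classical in
/-- The characterization of the family of double Schubert polynomials `𝔖_w(x;t)`, `w ∈ S_∞`:
each is homogeneous (in the `x`- and `t`-variables together), `𝔖_w(t;t) = δ_{w,id}`, and
`∂_i 𝔖_w` is `𝔖_{w s_i}` if `ℓ(w s_i) < ℓ(w)` and `0` otherwise. -/
structure IsDoubleSchubertFamily (S : SInf → Poly) : Prop where
  homogeneous : ∀ w, ∃ d : ℕ, (S w).IsHomogeneous d
  normalization : ∀ w, evalAtT (S w) = if w = 1 then 1 else 0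
  recursion : ∀ w i, dividedDifference i (S w) =
    if length (w * simpleTransposition i) < length w then S (w * simpleTransposition i) else 0

/-- A decorated letter of the long word. `⟨i, j, false⟩` is the unbarred letter `j^{(i)}` and
`⟨i, j, true⟩` is the barred letter `\overline{j}^{(i)}`; here `i` is the syllable and `j` the
value. -/
structure Letter where
  syllable : ℕ
  value : ℕ
  barred : Bool

/-- The weight of a letter: `x_i - t_j` for `j^{(i)}` and `t_j - t_i` for `\overline{j}^{(i)}`. -/
noncomputable def Letter.weight (a : Letter) : Poly :=
  if a.barred then tv a.value - tv a.syllable else xv a.syllable - tv a.value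

/-- The syllable `n, n-1, …, k+1, k, \overline{k+1}, …, \overline{n}`; with indices starting at
`0` the values run from `n - 1` down to `k`, then from `k + 1` up to `n - 1`. -/
def syllableWord (n k : ℕ) : List Letter :=
  (List.range' k (n - k)).reverse.map (fun j => ⟨k, j, false⟩) ++
    (List.range' (k + 1) (n - 1 - k)).map (fun j => ⟨k, j, true⟩)

/-- The long word: the concatenation of its `n` syllables in order. -/
def longWord (n : ℕ) : List Letter :=
  (List.range n).flatMap (syllableWord n)

/-- The weight of a (sub)word: the product of the weights of its letters. -/
noncomputable def wordWeight (π : List Letter) : Poly :=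
  (π.map Letter.weight).prod

open scoped Classical in
/-- The subword generating function: the sum of the weights of the subwords of `ω` whose word of
values lies in `D`. Here `ω.sublists` lists the subwords of `ω`, once for each choice of a set of
positions. -/
noncomputable def subwordSum (ω : List Letter) (D : Set (List ℕ)) : Poly :=
  ((ω.sublists.filter (fun π => π.map Letter.value ∈ D)).map wordWeight).sum

end VineModel

/-!
In the nilCoxeter algebra put `h_i(a) = 1 + a u_i`. The sum over the subwords of `ω` that are
reduced words of `w` is the coefficient of `u_w` in the product of the `h_{value}(weight)` over the
letters of `ω`. Let `H_k(x)` be the product belonging to the syllable `k`, with `x_k` replaced by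
`x`. The Yang–Baxter equation gives the exchange relation
`H_i(y) H_{i+1}(x) = H_i(x) H_{i+1}(y) h_i(y - x)`. Hence `s_i` acts on the product of the long word
as right multiplication by `h_i(x_{i+1} - x_i)`, which is the recursion for divided differences; and
at `x = t` every syllable telescopes to `1`.

Two solutions of the recursion differ, by induction on `ℓ(w)`, by a polynomial invariant under
all `s_i`. Such a polynomial involves no `x_i`, so it equals its specialization at `x = t`, which
is `0`. This uniqueness already holds within each `S_{n+1}`, so the sums for different `n` agree
and together form the required family.
-/

namespace VineModel

section NilCoxeter

/-- The relations of the nilCoxeter algebra of `S_∞`: the nilpotent analogue of the Coxeter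
presentation. -/
structure IsNilCoxeter {A : Type*} [Ring A] (u : ℕ → A) : Prop where
  sq : ∀ i, u i * u i = 0
  comm : ∀ i j, i + 1 < j → u i * u j = u j * u i
  braid : ∀ i, u i * u (i + 1) * u i = u (i + 1) * u i * u (i + 1)

variable {R A : Type*} [CommRing R] [Ring A] [Algebra R A]

/-- The factor `h_i(a) = 1 + a u_i`; it is the exponential of `a u_i`, since `u_i² = 0`. -/
def nilExp (u : ℕ → A) (i : ℕ) (a : R) : A := 1 + a • u i

/-- The product of `h_j(x - t_j)` over `m ≤ j < m + d` in decreasing order: the unbarred part of a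
syllable. -/
def descProd (u : ℕ → A) (t : ℕ → R) (x : R) (m d : ℕ) : A :=
  ((List.range' m d).reverse.map fun j => nilExp u j (x - t j)).prod

/-- The product of `h_j(t_j - c)` over `m ≤ j < m + d` in increasing order: the barred part of a
syllable. -/
def ascProd (u : ℕ → A) (t : ℕ → R) (c : R) (m d : ℕ) : A :=
  ((List.range' m d).map fun j => nilExp u j (t j - c)).prod

/-- The product `H_k(x)` belonging to `syllableWord n k`, with `x_k` replaced by `x`. -/
def syllableProd (u : ℕ → A) (t : ℕ → R) (n k : ℕ) (x : R) : A :=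
  descProd u t x k (n - k) * ascProd u t (t k) (k + 1) (n - 1 - k)

/-- The product `H_0(x_0) ⋯ H_{m-1}(x_{m-1})` belonging to the first `m` syllables of
`longWord n`. -/
def syllablesProd (u : ℕ → A) (t x : ℕ → R) (n m : ℕ) : A :=
  ((List.range m).map fun k => syllableProd u t n k (x k)).prod

variable {u : ℕ → A}

theorem nilExp_zero (i : ℕ) : nilExp u i (0 : R) = 1 := by simp [nilExp]

@[simp]
theorem descProd_zero (t : ℕ → R) (x : R) (m : ℕ) : descProd u t x m 0 = 1 := rfl

theorem descProd_succ (t : ℕ → R) (x : R) (m d : ℕ) :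
    descProd u t x m (d + 1) = descProd u t x (m + 1) d * nilExp u m (x - t m) := by
  simp [descProd, List.range'_succ]

@[simp]
theorem ascProd_zero (t : ℕ → R) (c : R) (m : ℕ) : ascProd u t c m 0 = 1 := rfl

theorem ascProd_succ (t : ℕ → R) (c : R) (m d : ℕ) :
    ascProd u t c m (d + 1) = nilExp u m (t m - c) * ascProd u t c (m + 1) d := by
  simp [ascProd, List.range'_succ]

theorem syllableProd_add (t : ℕ → R) (k d : ℕ) (x : R) :
    syllableProd u t (k + d + 1) k x =
      descProd u t x (k + 1) d * nilExp u k (x - t k) * ascProd u t (t k) (k + 1) d := by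
  rw [syllableProd, ← descProd_succ]
  congr 2 <;> omega

theorem syllablesProd_succ (t x : ℕ → R) (n m : ℕ) :
    syllablesProd u t x n (m + 1) = syllablesProd u t x n m * syllableProd u t n m (x m) := by
  simp [syllablesProd, List.range_succ]

theorem syllablesProd_comp_swap_of_le (t x : ℕ → R) (n : ℕ) {i m : ℕ} (hm : m ≤ i) :
    syllablesProd u t (x ∘ Equiv.swap i (i + 1)) n m = syllablesProd u t x n m := by
  refine congrArg List.prod (List.map_congr_left fun k hk => ?_)
  have hk := List.mem_range.1 hk
  rw [Function.comp_apply, Equiv.swap_apply_of_ne_of_ne (by omega) (by omega)]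

namespace IsNilCoxeter

theorem nilExp_mul (hu : IsNilCoxeter u) (i : ℕ) (a b : R) :
    nilExp u i a * nilExp u i b = nilExp u i (a + b) := by
  simp only [nilExp, add_mul, mul_add, one_mul, mul_one, smul_mul_assoc, mul_smul_comm, hu.sq]
  module

theorem commute_nilExp (hu : IsNilCoxeter u) {i j : ℕ} (hij : i + 1 < j) (a b : R) :
    Commute (nilExp u i a) (nilExp u j b) :=
  (Commute.one_left _).add_left (((Commute.one_right _).add_right
    (Commute.smul_right (hu.comm i j hij) b)).smul_left a)

theorem yangBaxter (hu : IsNilCoxeter u) (i : ℕ) {a b c : R} (h : b = a + c) :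
    nilExp u i a * nilExp u (i + 1) b * nilExp u i c =
      nilExp u (i + 1) c * nilExp u i b * nilExp u (i + 1) a := by
  subst h
  simp only [nilExp, add_mul, mul_add, one_mul, mul_one, smul_mul_assoc, mul_smul_comm, hu.sq,
    hu.braid, smul_add]
  module

theorem commute_prod_nilExp (hu : IsNilCoxeter u) {i : ℕ} {l : List ℕ} (hl : ∀ j ∈ l, i + 1 < j)
    (a : R) (b : ℕ → R) : Commute (nilExp u i a) (l.map fun j => nilExp u j (b j)).prod := by
  refine Commute.list_prod_right _ _ fun y hy => ?_
  obtain ⟨j, hj, rfl⟩ := List.mem_map.1 hy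
  exact hu.commute_nilExp (hl j hj) a (b j)

theorem commute_descProd (hu : IsNilCoxeter u) (t : ℕ → R) (a x : R) {i m : ℕ} (him : i + 1 < m)
    (d : ℕ) : Commute (nilExp u i a) (descProd u t x m d) := by
  refine hu.commute_prod_nilExp (fun j hj => ?_) a _
  rw [List.mem_reverse, List.mem_range'_1] at hj
  omega

theorem commute_ascProd (hu : IsNilCoxeter u) (t : ℕ → R) (a c : R) {i m : ℕ} (him : i + 1 < m)
    (d : ℕ) : Commute (nilExp u i a) (ascProd u t c m d) := by
  refine hu.commute_prod_nilExp (fun j hj => ?_) a _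
  rw [List.mem_range'_1] at hj
  omega

theorem commute_syllableProd (hu : IsNilCoxeter u) (t : ℕ → R) (a x : R) {i k : ℕ}
    (hik : i + 1 < k) (n : ℕ) : Commute (nilExp u i a) (syllableProd u t n k x) :=
  (hu.commute_descProd t a x hik _).mul_right (hu.commute_ascProd t a _ (by omega) _)

theorem descProd_mul_ascProd (hu : IsNilCoxeter u) (t : ℕ → R) (c : R) (m d : ℕ) :
    descProd u t c m d * ascProd u t c m d = 1 := by
  induction d generalizing m with
  | zero => simp
  | succ d ih =>
    have hcancel : nilExp u m (c - t m) * nilExp u m (t m - c) = 1 := by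
      rw [hu.nilExp_mul, sub_add_sub_cancel, sub_self, nilExp_zero]
    rw [descProd_succ, ascProd_succ, mul_assoc, ← mul_assoc (nilExp _ _ _), hcancel, one_mul, ih]

theorem syllableProd_self (hu : IsNilCoxeter u) (t : ℕ → R) {n k : ℕ} (hk : k < n) :
    syllableProd u t n k (t k) = 1 := by
  obtain ⟨d, rfl⟩ := Nat.exists_eq_add_of_lt hk
  rw [syllableProd_add, sub_self, nilExp_zero, mul_one, hu.descProd_mul_ascProd]

theorem descProd_exchange (hu : IsNilCoxeter u) (t : ℕ → R) (x y c : R) (m d : ℕ) :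
    descProd u t y (m + 1) d * nilExp u m (y - c) * ascProd u t c (m + 1) d *
        descProd u t x (m + 1) d =
      descProd u t x (m + 1) d * nilExp u m (x - c) * ascProd u t c (m + 1) d *
        descProd u t y (m + 1) d * nilExp u m (y - x) := by
  induction d generalizing m with
  | zero => simp [hu.nilExp_mul]
  | succ d ih =>
    specialize ih (m + 1)
    simp only [descProd_succ, ascProd_succ]
    have hDx (a : R) := hu.commute_descProd t a x (Nat.lt_add_one (m + 1)) d
    have hDy (a : R) := hu.commute_descProd t a y (Nat.lt_add_one (m + 1)) d
    have hC (a : R) := hu.commute_ascProd t a c (Nat.lt_add_one (m + 1)) d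
    generalize descProd u t x (m + 1 + 1) d = Dx at *
    generalize descProd u t y (m + 1 + 1) d = Dy at *
    generalize ascProd u t c (m + 1 + 1) d = C at *
    generalize t (m + 1) = e
    have yangBaxter_c (z : R) :
        nilExp u m (e - c) * nilExp u (m + 1) (z - c) * nilExp u m (z - e) =
          nilExp u (m + 1) (z - e) * nilExp u m (z - c) * nilExp u (m + 1) (e - c) :=
      hu.yangBaxter m (by ring)
    have yangBaxter_xy :
        nilExp u m (x - e) * nilExp u (m + 1) (y - e) * nilExp u m (y - x) =
          nilExp u (m + 1) (y - x) * nilExp u m (y - e) * nilExp u (m + 1) (x - e) :=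
      hu.yangBaxter m (by ring)
    -- Yang–Baxter turns the factors `m + 1, m, m + 1` into `m, m + 1, m`, whose outer factors
    -- commute with `Dx`, `Dy`, `C`; what remains inside is the case `m + 1`. Then the steps are
    -- undone.
    calc
      _ = Dy * (nilExp u (m + 1) (y - e) * nilExp u m (y - c) * nilExp u (m + 1) (e - c)) * C *
          Dx * nilExp u (m + 1) (x - e) := by simp only [mul_assoc]
      _ = nilExp u m (e - c) * (Dy * nilExp u (m + 1) (y - c) * C * Dx) * nilExp u m (y - e) *
          nilExp u (m + 1) (x - e) := by
        rw [← yangBaxter_c]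
        simp only [mul_assoc, (hDx _).left_comm, (hDy _).left_comm, (hC _).left_comm]
      _ = nilExp u m (e - c) * Dx * nilExp u (m + 1) (x - c) * C * Dy *
          (nilExp u (m + 1) (y - x) * nilExp u m (y - e) * nilExp u (m + 1) (x - e)) := by
        rw [ih]
        simp only [mul_assoc]
      _ = Dx * (nilExp u m (e - c) * nilExp u (m + 1) (x - c) * nilExp u m (x - e)) * C * Dy *
          nilExp u (m + 1) (y - e) * nilExp u m (y - x) := by
        rw [← yangBaxter_xy]
        simp only [mul_assoc, (hDx _).left_comm, (hDy _).left_comm, (hC _).left_comm]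
      _ = _ := by
        rw [yangBaxter_c]
        simp only [mul_assoc]

theorem syllableProd_exchange (hu : IsNilCoxeter u) (t : ℕ → R) (x y : R) {n i : ℕ}
    (hi : i + 1 < n) :
    syllableProd u t n i y * syllableProd u t n (i + 1) x =
      syllableProd u t n i x * syllableProd u t n (i + 1) y * nilExp u i (y - x) := by
  obtain ⟨d, rfl⟩ := Nat.exists_eq_add_of_lt hi
  have hC := hu.commute_ascProd t (y - x) (t (i + 1)) (Nat.lt_add_one (i + 1)) d
  have syllable_left (z : R) : syllableProd u t (i + 1 + d + 1) i z =
      descProd u t z (i + 1) (d + 1) * nilExp u i (z - t i) *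
        ascProd u t (t i) (i + 1) (d + 1) := by
    rw [← syllableProd_add, show i + (d + 1) + 1 = i + 1 + d + 1 by omega]
  simp only [syllable_left, syllableProd_add, ← descProd_succ t _ (i + 1) d]
  rw [← mul_assoc, hu.descProd_exchange t x y (t i) i (d + 1)]
  simp only [mul_assoc, hC.eq]

theorem syllablesProd_self (hu : IsNilCoxeter u) (t : ℕ → R) (n : ℕ) :
    syllablesProd u t t n n = 1 := by
  refine List.prod_eq_one fun b hb => ?_
  obtain ⟨k, hk, rfl⟩ := List.mem_map.1 hb
  exact hu.syllableProd_self t (List.mem_range.1 hk)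

theorem syllablesProd_comp_swap_of_add_two_le (hu : IsNilCoxeter u) (t x : ℕ → R) {n i m : ℕ}
    (hn : i + 1 < n) (hm : i + 2 ≤ m) :
    syllablesProd u t (x ∘ Equiv.swap i (i + 1)) n m =
      syllablesProd u t x n m * nilExp u i (x (i + 1) - x i) := by
  induction m, hm using Nat.le_induction with
  | base =>
    simp only [syllablesProd_succ, syllablesProd_comp_swap_of_le t x n le_rfl, Function.comp_apply,
      Equiv.swap_apply_left, Equiv.swap_apply_right, mul_assoc]
    rw [hu.syllableProd_exchange t _ _ hn, mul_assoc]
  | succ m hm ih =>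
    rw [syllablesProd_succ, ih, syllablesProd_succ, Function.comp_apply,
      Equiv.swap_apply_of_ne_of_ne (by omega) (by omega), mul_assoc, mul_assoc,
      (hu.commute_syllableProd t _ (x m) (by omega) n).eq]

theorem syllablesProd_comp_swap (hu : IsNilCoxeter u) (t x : ℕ → R) {n i : ℕ} (hi : i < n) :
    syllablesProd u t (x ∘ Equiv.swap i (i + 1)) n n =
      syllablesProd u t x n n * nilExp u i (x (i + 1) - x i) := by
  rcases Nat.lt_or_ge (i + 1) n with hn | hn
  · exact hu.syllablesProd_comp_swap_of_add_two_le t x hn hn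
  · obtain rfl : n = i + 1 := by omega
    have last_syllable (z : R) : syllableProd u t (i + 1) i z = nilExp u i (z - t i) := by
      simpa using syllableProd_add (u := u) t i 0 z
    rw [syllablesProd_succ, syllablesProd_succ, syllablesProd_comp_swap_of_le t x _ le_rfl,
      Function.comp_apply, Equiv.swap_apply_left, last_syllable, last_syllable, mul_assoc,
      hu.nilExp_mul, sub_add_sub_comm, add_comm (x i), add_sub_add_right_eq_sub]

end IsNilCoxeter

end NilCoxeter

section Length

theorem simpleTransposition_mul_self (i : ℕ) :
    simpleTransposition i * simpleTransposition i = 1 :=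
  Subtype.ext (Equiv.swap_mul_self i (i + 1))

theorem simpleTransposition_comm {i j : ℕ} (h : i + 1 < j) :
    simpleTransposition i * simpleTransposition j =
      simpleTransposition j * simpleTransposition i :=
  Subtype.ext (Equiv.Perm.disjoint_swap_swap (by simp; omega)).commute.eq

theorem simpleTransposition_braid (i : ℕ) :
    simpleTransposition i * simpleTransposition (i + 1) * simpleTransposition i =
      simpleTransposition (i + 1) * simpleTransposition i * simpleTransposition (i + 1) := by
  refine Subtype.ext ?_
  change Equiv.swap i (i + 1) * Equiv.swap (i + 1) (i + 2) * Equiv.swap i (i + 1) =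
    Equiv.swap (i + 1) (i + 2) * Equiv.swap i (i + 1) * Equiv.swap (i + 1) (i + 2)
  rw [Equiv.swap_mul_swap_mul_swap (by omega) (by omega), Equiv.swap_comm i (i + 1),
    Equiv.swap_comm (i + 1) (i + 2), Equiv.swap_mul_swap_mul_swap (by omega) (by omega),
    Equiv.swap_comm]

theorem mul_simpleTransposition_cancel (w : SInf) (i : ℕ) :
    w * simpleTransposition i * simpleTransposition i = w := by
  rw [mul_assoc, simpleTransposition_mul_self, mul_one]

theorem mul_simpleTransposition_apply (w : SInf) (i j : ℕ) :
    (w * simpleTransposition i).1 j = w.1 (Equiv.swap i (i + 1) j) := rfl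

theorem mul_simpleTransposition_apply_left (w : SInf) (i : ℕ) :
    (w * simpleTransposition i).1 i = w.1 (i + 1) := by
  rw [mul_simpleTransposition_apply, Equiv.swap_apply_left]

theorem mul_simpleTransposition_apply_right (w : SInf) (i : ℕ) :
    (w * simpleTransposition i).1 (i + 1) = w.1 i := by
  rw [mul_simpleTransposition_apply, Equiv.swap_apply_right]

theorem mul_simpleTransposition_apply_of_ne (w : SInf) {i j : ℕ} (h : j ≠ i) (h' : j ≠ i + 1) :
    (w * simpleTransposition i).1 j = w.1 j := by
  rw [mul_simpleTransposition_apply, Equiv.swap_apply_of_ne_of_ne h h']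

/-- A right descent of `w`, by the value criterion `w(i + 1) < w(i)`. -/
def IsDescent (w : SInf) (i : ℕ) : Prop := w.1 (i + 1) < w.1 i

instance (w : SInf) (i : ℕ) : Decidable (IsDescent w i) := Nat.decLt _ _

theorem not_isDescent_iff {w : SInf} {i : ℕ} : ¬ IsDescent w i ↔ w.1 i < w.1 (i + 1) :=
  not_lt.trans (w.1.injective.ne (Nat.lt_succ_self i).ne).le_iff_lt

theorem isDescent_mul_simpleTransposition_iff {w : SInf} {i : ℕ} :
    IsDescent (w * simpleTransposition i) i ↔ ¬ IsDescent w i := by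
  rw [not_isDescent_iff, IsDescent, mul_simpleTransposition_apply_left,
    mul_simpleTransposition_apply_right]

theorem isDescent_mul_simpleTransposition_iff_of_far {w : SInf} {i j : ℕ}
    (h : i + 1 < j ∨ j + 1 < i) : IsDescent (w * simpleTransposition i) j ↔ IsDescent w j := by
  rw [IsDescent, mul_simpleTransposition_apply_of_ne w (by omega) (by omega),
    mul_simpleTransposition_apply_of_ne w (by omega) (by omega), IsDescent]

/-- The set of inversions of `w`, whose cardinality is `length w`. -/
def inversions (w : SInf) : Set (ℕ × ℕ) := {p | p.1 < p.2 ∧ w.1 p.2 < w.1 p.1}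

theorem exists_mem_symmetricSubgroup (w : SInf) : ∃ n, w ∈ symmetricSubgroup (n + 1) := by
  obtain ⟨n, hn⟩ := w.2.bddAbove
  exact ⟨n, fun i hi => by_contra fun h => absurd (hn h) (by omega)⟩

theorem snd_lt_of_mem_inversions {n : ℕ} {w : SInf} (hw : w ∈ symmetricSubgroup n) {p : ℕ × ℕ}
    (hp : p ∈ inversions w) : p.2 < n := by
  obtain ⟨hlt, hinv⟩ := hp
  by_contra! hn
  rw [hw p.2 hn] at hinv
  have hfix := w.1.injective (hw (w.1 p.1) (hn.trans hinv.le))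
  omega

theorem finite_inversions (w : SInf) : (inversions w).Finite := by
  obtain ⟨n, hw⟩ := exists_mem_symmetricSubgroup w
  refine ((Set.finite_Iio (n + 1)).prod (Set.finite_Iio (n + 1))).subset fun p hp => ?_
  have h := snd_lt_of_mem_inversions hw hp
  exact ⟨hp.1.trans h, h⟩

theorem inversions_mul_simpleTransposition {w : SInf} {i : ℕ} (h : ¬ IsDescent w i) :
    inversions (w * simpleTransposition i) = insert (i, i + 1)
      ((Equiv.swap i (i + 1)).prodCongr (Equiv.swap i (i + 1)) ⁻¹' inversions w) := by
  rw [not_isDescent_iff] at h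
  ext ⟨p, q⟩
  simp only [inversions, Set.mem_ofPred_eq, mul_simpleTransposition_apply, Set.mem_insert_iff,
    Prod.mk.injEq, Set.mem_preimage, Equiv.prodCongr_apply, Prod.map_apply]
  grind

theorem length_mul_simpleTransposition_of_not_isDescent {w : SInf} {i : ℕ}
    (h : ¬ IsDescent w i) : length (w * simpleTransposition i) = length w + 1 := by
  set σ := (Equiv.swap i (i + 1)).prodCongr (Equiv.swap i (i + 1)) with hσ
  have hnotMem : (i, i + 1) ∉ σ ⁻¹' inversions w := fun hmem => by
    have hlt := hmem.1
    simp only [hσ, Equiv.prodCongr_apply, Prod.map_apply, Equiv.swap_apply_left,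
      Equiv.swap_apply_right] at hlt
    omega
  calc length (w * simpleTransposition i)
      = (insert (i, i + 1) (σ ⁻¹' inversions w)).ncard :=
        congrArg Set.ncard (inversions_mul_simpleTransposition h)
    _ = (σ ⁻¹' inversions w).ncard + 1 :=
        Set.ncard_insert_of_notMem hnotMem
          ((finite_inversions w).preimage σ.injective.injOn)
    _ = length w + 1 := by
        rw [Set.ncard_preimage_of_injective_subset_range σ.injective (by simp)]
        rfl

theorem length_mul_simpleTransposition_of_isDescent {w : SInf} {i : ℕ} (h : IsDescent w i) :
    length (w * simpleTransposition i) + 1 = length w := by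
  rw [← length_mul_simpleTransposition_of_not_isDescent
    (not_not.2 h ∘ isDescent_mul_simpleTransposition_iff.1), mul_simpleTransposition_cancel]

theorem length_mul_simpleTransposition_lt_iff {w : SInf} {i : ℕ} :
    length (w * simpleTransposition i) < length w ↔ IsDescent w i := by
  by_cases h : IsDescent w i
  · exact iff_of_true (by have := length_mul_simpleTransposition_of_isDescent h; omega) h
  · exact iff_of_false
      (by have := length_mul_simpleTransposition_of_not_isDescent h; omega) h

theorem length_mul_simpleTransposition_le (w : SInf) (i : ℕ) :
    length (w * simpleTransposition i) ≤ length w + 1 := by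
  by_cases h : IsDescent w i
  · have := length_mul_simpleTransposition_of_isDescent h
    omega
  · exact (length_mul_simpleTransposition_of_not_isDescent h).le

theorem length_one : length 1 = 0 := by
  have hempty : inversions 1 = ∅ := Set.eq_empty_of_forall_notMem fun _ hp => lt_asymm hp.1 hp.2
  exact (congrArg Set.ncard hempty).trans (Set.ncard_empty _)

theorem length_prod_simpleTransposition_le (l : List ℕ) :
    length (l.map simpleTransposition).prod ≤ l.length := by
  induction l using List.reverseRecOn with
  | nil => simp [length_one]
  | append_singleton l i ih =>
    rw [List.map_append, List.prod_append, List.map_singleton, List.prod_singleton,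
      List.length_append, List.length_singleton]
    exact (length_mul_simpleTransposition_le _ i).trans (Nat.succ_le_succ ih)

theorem nil_mem_reducedWords_iff {w : SInf} : [] ∈ reducedWords w ↔ w = 1 := by
  constructor
  · rintro ⟨h, -⟩
    exact h.symm
  · rintro rfl
    exact ⟨rfl, length_one.symm⟩

theorem append_mem_reducedWords_iff {l : List ℕ} {i : ℕ} {w : SInf} :
    l ++ [i] ∈ reducedWords w ↔
      IsDescent w i ∧ l ∈ reducedWords (w * simpleTransposition i) := by
  simp only [reducedWords, Set.mem_ofPred_eq, List.map_append, List.prod_append, List.map_singleton,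
    List.prod_singleton, List.length_append, List.length_singleton]
  constructor
  · rintro ⟨rfl, hl⟩
    rw [mul_simpleTransposition_cancel, isDescent_mul_simpleTransposition_iff]
    have hle := length_prod_simpleTransposition_le l
    have hasc : ¬ IsDescent (l.map simpleTransposition).prod i := fun h => by
      have := length_mul_simpleTransposition_of_isDescent h
      omega
    have := length_mul_simpleTransposition_of_not_isDescent hasc
    exact ⟨hasc, rfl, by omega⟩
  · rintro ⟨h, hw, hl⟩
    rw [hw, mul_simpleTransposition_cancel, hl]
    exact ⟨rfl, length_mul_simpleTransposition_of_isDescent h⟩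

theorem symmetricSubgroup_mono : Monotone symmetricSubgroup :=
  fun _ _ h _ hw i hi => hw i (h.trans hi)

theorem IsDescent.lt {n : ℕ} {w : SInf} (hw : w ∈ symmetricSubgroup (n + 1)) {i : ℕ}
    (h : IsDescent w i) : i < n :=
  Nat.succ_lt_succ_iff.1 (snd_lt_of_mem_inversions (p := (i, i + 1)) hw ⟨Nat.lt_succ_self i, h⟩)

theorem IsDescent.mul_mem_symmetricSubgroup {n : ℕ} {w : SInf} (hw : w ∈ symmetricSubgroup (n + 1))
    {i : ℕ} (h : IsDescent w i) : w * simpleTransposition i ∈ symmetricSubgroup (n + 1) := by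
  intro j hj
  have := h.lt hw
  rw [mul_simpleTransposition_apply_of_ne _ (by omega) (by omega), hw j hj]

end Length

section NilCoxeterModule

variable (R : Type*) [CommRing R]

/-- Right multiplication by the generator `u_i` of the nilCoxeter algebra, on formal sums
`∑ f(w) u_w` written as functions `f`. -/
noncomputable def mulRightGen (i : ℕ) : Module.End R (SInf → R) :=
  LinearMap.pi fun w => if IsDescent w i then LinearMap.proj (w * simpleTransposition i) else 0

variable {R} in
theorem mulRightGen_apply (i : ℕ) (f : SInf → R) (w : SInf) :
    mulRightGen R i f w = if IsDescent w i then f (w * simpleTransposition i) else 0 := by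
  rw [mulRightGen, LinearMap.pi_apply]
  split_ifs <;> rfl

theorem isNilCoxeter_mulRightGen : IsNilCoxeter (mulRightGen R) where
  sq i := by
    refine LinearMap.ext fun f => funext fun w => ?_
    simp only [Module.End.mul_apply, mulRightGen_apply, isDescent_mul_simpleTransposition_iff,
      LinearMap.zero_apply, Pi.zero_apply]
    split_ifs <;> rfl
  comm i j h := by
    refine LinearMap.ext fun f => funext fun w => ?_
    simp only [Module.End.mul_apply, mulRightGen_apply,
      isDescent_mul_simpleTransposition_iff_of_far (.inl h),
      isDescent_mul_simpleTransposition_iff_of_far (.inr h), mul_assoc, simpleTransposition_comm h]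
    split_ifs <;> rfl
  braid i := by
    refine LinearMap.ext fun f => funext fun w => ?_
    have apply_add_two (v : SInf) : (v * simpleTransposition i).1 (i + 1 + 1) = v.1 (i + 1 + 1) :=
      mul_simpleTransposition_apply_of_ne v (by omega) (by omega)
    have apply_self (v : SInf) : (v * simpleTransposition (i + 1)).1 i = v.1 i :=
      mul_simpleTransposition_apply_of_ne v (by omega) (by omega)
    have hbraid := congrArg (w * ·) (simpleTransposition_braid i)
    simp only [← mul_assoc] at hbraid
    simp only [Module.End.mul_apply, mulRightGen_apply, IsDescent, apply_add_two, apply_self,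
      mul_simpleTransposition_apply_left, mul_simpleTransposition_apply_right, hbraid]
    split_ifs <;> rfl

/-- The endomorphisms of the formal sums `∑ f(w) u_w`, acting from the right: with the reversed
product, right multiplications compose in the order in which they are written. -/
abbrev RightEnd : Type _ := (Module.End R (SInf → R))ᵐᵒᵖ

/-- The generator `u_i` of the nilCoxeter algebra, acting from the right. -/
noncomputable def nilGen (i : ℕ) : RightEnd R := MulOpposite.op (mulRightGen R i)

theorem isNilCoxeter_nilGen : IsNilCoxeter (nilGen R) where
  sq i := congrArg MulOpposite.op ((isNilCoxeter_mulRightGen R).sq i)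
  comm i j h := congrArg MulOpposite.op ((isNilCoxeter_mulRightGen R).comm i j h).symm
  braid i := by
    have hbraid := congrArg MulOpposite.op ((isNilCoxeter_mulRightGen R).braid i)
    simpa only [MulOpposite.op_mul, mul_assoc, nilGen] using hbraid

variable {R}

open scoped Classical in
/-- The coefficient of `u_w` in an element `P` of the nilCoxeter algebra, recovered from `P` acting
on `u_1`. -/
noncomputable def nilCoeff (P : RightEnd R) (w : SInf) : R :=
  P.unop (fun v => if v = 1 then 1 else 0) w

open scoped Classical in
theorem nilCoeff_one (w : SInf) : nilCoeff (1 : RightEnd R) w = if w = 1 then 1 else 0 := rfl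

theorem nilCoeff_mul_nilExp (P : RightEnd R) (i : ℕ) (a : R) (w : SInf) :
    nilCoeff (P * nilExp (nilGen R) i a) w = nilCoeff P w +
      a * if IsDescent w i then nilCoeff P (w * simpleTransposition i) else 0 := by
  simp only [nilCoeff, nilExp, mul_add, mul_one, mul_smul_comm, MulOpposite.unop_add,
    MulOpposite.unop_smul, MulOpposite.unop_mul, nilGen, MulOpposite.unop_op, LinearMap.add_apply,
    LinearMap.smul_apply, Pi.add_apply, Pi.smul_apply, Module.End.mul_apply, mulRightGen_apply,
    smul_eq_mul]

end NilCoxeterModule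

section SubwordSum

theorem isHomogeneous_weight (a : Letter) : a.weight.IsHomogeneous 1 := by
  rw [Letter.weight]
  split_ifs <;> exact (MvPolynomial.isHomogeneous_X _ _).sub (MvPolynomial.isHomogeneous_X _ _)

theorem isHomogeneous_wordWeight (π : List Letter) : (wordWeight π).IsHomogeneous π.length := by
  induction π with
  | nil => exact MvPolynomial.isHomogeneous_one _ _
  | cons a π ih =>
    rw [wordWeight, List.map_cons, List.prod_cons, List.length_cons, add_comm]
    exact (isHomogeneous_weight a).mul ih

theorem isHomogeneous_subwordSum (ω : List Letter) {D : Set (List ℕ)} {d : ℕ}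
    (hD : ∀ l ∈ D, l.length = d) : (subwordSum ω D).IsHomogeneous d := by
  classical
  refine (MvPolynomial.homogeneousSubmodule (ℕ ⊕ ℕ) ℤ d).toAddSubmonoid.list_sum_mem fun f hf => ?_
  obtain ⟨π, hπ, rfl⟩ := List.mem_map.1 hf
  have hlength := hD _ (of_decide_eq_true (List.mem_filter.1 hπ).2)
  rw [List.length_map] at hlength
  exact hlength ▸ isHomogeneous_wordWeight π

open scoped Classical in
theorem subwordSum_nil (D : Set (List ℕ)) : subwordSum [] D = if [] ∈ D then 1 else 0 := by
  by_cases h : [] ∈ D <;> simp [subwordSum, wordWeight, h]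

theorem subwordSum_empty (ω : List Letter) : subwordSum ω ∅ = 0 := by
  simp [subwordSum]

theorem subwordSum_append_singleton (ω : List Letter) (a : Letter) (D : Set (List ℕ)) :
    subwordSum (ω ++ [a]) D =
      subwordSum ω D + a.weight * subwordSum ω {l | l ++ [a.value] ∈ D} := by
  classical
  have weight_append (π : List Letter) : wordWeight (π ++ [a]) = a.weight * wordWeight π := by
    simp [wordWeight, mul_comm]
  simp only [subwordSum, List.sublists_concat, List.filter_append, List.filter_map, List.map_append,
    List.sum_append, List.map_map, Function.comp_def, weight_append, List.sum_map_mul_left,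
    List.map_cons, List.map_nil, Set.mem_ofPred_eq]

theorem subwordSum_append_singleton_reducedWords (ω : List Letter) (a : Letter) (w : SInf) :
    subwordSum (ω ++ [a]) (reducedWords w) = subwordSum ω (reducedWords w) +
      a.weight * if IsDescent w a.value then
        subwordSum ω (reducedWords (w * simpleTransposition a.value)) else 0 := by
  rw [subwordSum_append_singleton]
  split_ifs with h
  · simp only [append_mem_reducedWords_iff, h, true_and, Set.ofPred_mem_eq]
  · simp only [append_mem_reducedWords_iff, h, false_and, Set.ofPred_false, subwordSum_empty]

/-- The product of the factors `h_{value}(b)` over the letters of `ω`, where `b` assigns a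
parameter to each letter. -/
def wordProd {R A : Type*} [CommRing R] [Ring A] [Algebra R A] (u : ℕ → A) (b : Letter → R)
    (ω : List Letter) : A :=
  (ω.map fun a => nilExp u a.value (b a)).prod

variable {R F : Type*} [CommRing R] [FunLike F Poly R] [RingHomClass F Poly R]

theorem map_subwordSum_reducedWords (φ : F) (ω : List Letter) (w : SInf) :
    φ (subwordSum ω (reducedWords w)) = nilCoeff (wordProd (nilGen R) (φ ∘ Letter.weight) ω) w := by
  classical
  induction ω using List.reverseRecOn generalizing w with
  | nil =>
    simp only [subwordSum_nil, nil_mem_reducedWords_iff, wordProd, List.map_nil, List.prod_nil,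
      nilCoeff_one]
    split_ifs <;> simp
  | append_singleton ω a ih =>
    rw [subwordSum_append_singleton_reducedWords, wordProd, List.map_append, List.prod_append,
      ← wordProd, List.map_singleton, List.prod_singleton, nilCoeff_mul_nilExp, map_add, map_mul,
      apply_ite φ, map_zero, ih, ih]
    rfl

theorem wordProd_longWord {A : Type*} [Ring A] [Algebra R A] (u : ℕ → A) (φ : F) (n : ℕ) :
    wordProd u (φ ∘ Letter.weight) (longWord n) = syllablesProd u (φ ∘ tv) (φ ∘ xv) n n := by
  rw [wordProd, longWord, List.map_flatMap, List.flatMap_def, List.prod_flatten, List.map_map]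
  refine congrArg List.prod (List.map_congr_left fun k _ => ?_)
  simp [syllableWord, syllableProd, descProd, ascProd, Letter.weight, Function.comp_def]

theorem map_subwordSum_longWord (φ : F) (n : ℕ) (w : SInf) :
    φ (subwordSum (longWord n) (reducedWords w)) =
      nilCoeff (syllablesProd (nilGen R) (φ ∘ tv) (φ ∘ xv) n n) w := by
  rw [map_subwordSum_reducedWords, wordProd_longWord]

theorem subwordSum_longWord (n : ℕ) (w : SInf) :
    subwordSum (longWord n) (reducedWords w) =
      nilCoeff (syllablesProd (nilGen Poly) tv xv n n) w :=
  map_subwordSum_longWord (RingHom.id Poly) n w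

open scoped Classical in
theorem evalAtT_subwordSum_longWord (n : ℕ) (w : SInf) :
    evalAtT (subwordSum (longWord n) (reducedWords w)) = if w = 1 then 1 else 0 := by
  have eval_t : MvPolynomial.aeval (R := ℤ) (Sum.elim tv tv) ∘ tv = tv :=
    funext fun j => MvPolynomial.aeval_X _ _
  have eval_x : MvPolynomial.aeval (R := ℤ) (Sum.elim tv tv) ∘ xv = tv :=
    funext fun j => MvPolynomial.aeval_X _ _
  rw [evalAtT, map_subwordSum_longWord, eval_t, eval_x,
    (isNilCoxeter_nilGen Poly).syllablesProd_self, nilCoeff_one]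

theorem act_subwordSum_longWord (σ : SInf) (n : ℕ) (w : SInf) :
    act σ (subwordSum (longWord n) (reducedWords w)) =
      nilCoeff (syllablesProd (nilGen Poly) tv (xv ∘ σ.1) n n) w := by
  have act_t : MvPolynomial.rename (R := ℤ) (Sum.map σ.1 id) ∘ tv = tv :=
    funext fun j => MvPolynomial.rename_X _ _
  have act_x : MvPolynomial.rename (R := ℤ) (Sum.map σ.1 id) ∘ xv = xv ∘ σ.1 :=
    funext fun j => MvPolynomial.rename_X _ _
  rw [act, map_subwordSum_longWord, act_t, act_x]

end SubwordSum

section DividedDifference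

theorem xv_sub_xv_ne_zero (i : ℕ) : xv i - xv (i + 1) ≠ 0 := by
  rw [sub_ne_zero, xv, xv, Ne, MvPolynomial.X_inj]
  simp

theorem dividedDifference_eq_iff {i : ℕ} {f g : Poly} :
    dividedDifference i f = g ↔
      (xv i - xv (i + 1)) * g = f - act (simpleTransposition i) f := by
  rw [← dividedDifference_spec, mul_right_inj' (xv_sub_xv_ne_zero i), eq_comm]

theorem act_sub_eq_self_of_dividedDifference_eq {i : ℕ} {f g : Poly}
    (h : dividedDifference i f = dividedDifference i g) :
    act (simpleTransposition i) (f - g) = f - g := by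
  have hfg := dividedDifference_eq_iff.1 h
  rw [dividedDifference_spec] at hfg
  simp only [act, map_sub] at hfg ⊢
  linear_combination hfg

theorem dividedDifference_subwordSum_longWord {n : ℕ} {w : SInf}
    (hw : w ∈ symmetricSubgroup (n + 1)) (i : ℕ) :
    dividedDifference i (subwordSum (longWord n) (reducedWords w)) =
      if IsDescent w i then subwordSum (longWord n) (reducedWords (w * simpleTransposition i))
      else 0 := by
  have hact : act (simpleTransposition i) (subwordSum (longWord n) (reducedWords w)) =
      nilCoeff (syllablesProd (nilGen Poly) tv (xv ∘ Equiv.swap i (i + 1)) n n) w :=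
    act_subwordSum_longWord _ n w
  rw [dividedDifference_eq_iff, hact]
  simp only [subwordSum_longWord]
  rcases Nat.lt_or_ge i n with hi | hi
  · rw [(isNilCoxeter_nilGen Poly).syllablesProd_comp_swap tv xv hi, nilCoeff_mul_nilExp]
    ring
  · rw [syllablesProd_comp_swap_of_le tv xv n hi, if_neg fun h => (h.lt hw).not_ge hi, mul_zero,
      sub_self]

theorem inl_notMem_vars_of_act_eq_self {f : Poly}
    (hf : ∀ i, act (simpleTransposition i) f = f) (j : ℕ) : Sum.inl j ∉ f.vars := by
  intro hj
  have hsucc (k : ℕ) (hk : Sum.inl k ∈ f.vars) : Sum.inl (k + 1) ∈ f.vars := by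
    rw [← hf k, act] at hk
    obtain ⟨v | v, hv, hvk⟩ := MvPolynomial.mem_vars_rename _ _ hk
    · have hswap : Equiv.swap k (k + 1) v = k := Sum.inl.inj hvk
      obtain rfl : v = k + 1 := by simpa [Equiv.swap_apply_eq_iff] using hswap
      exact hv
    · simp at hvk
  have hall (k : ℕ) : Sum.inl (j + k) ∈ f.vars := by
    induction k with
    | zero => exact hj
    | succ k ih => exact hsucc _ ih
  have hinj : Function.Injective fun k : ℕ => (Sum.inl (j + k) : ℕ ⊕ ℕ) :=
    Sum.inl_injective.comp (add_right_injective j)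
  exact Set.infinite_of_injective_forall_mem hinj hall f.vars.finite_toSet

theorem evalAtT_eq_self_of_act_eq_self {f : Poly}
    (hf : ∀ i, act (simpleTransposition i) f = f) : evalAtT f = f := by
  refine MvPolynomial.hom_congr_vars (f₂ := RingHom.id Poly)
    (f₁ := (MvPolynomial.aeval (R := ℤ) (Sum.elim tv tv)).toRingHom) (RingHom.ext_int _ _) ?_ rfl
  rintro (j | j) hj -
  · exact absurd hj (inl_notMem_vars_of_act_eq_self hf j)
  · simp [tv]

end DividedDifference

section DoubleSchubert

open scoped Classical in
/-- The normalization and the recursion of double Schubert polynomials, imposed on the members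
indexed by `W` only. This permits comparing families that are correct on a single `S_{n+1}`. -/
structure IsDoubleSchubertOn (W : Set SInf) (S : SInf → Poly) : Prop where
  normalization : ∀ w ∈ W, evalAtT (S w) = if w = 1 then 1 else 0
  recursion : ∀ w ∈ W, ∀ i, dividedDifference i (S w) =
    if IsDescent w i then S (w * simpleTransposition i) else 0

theorem IsDoubleSchubertOn.mono {V W : Set SInf} {S : SInf → Poly} (hS : IsDoubleSchubertOn W S)
    (hVW : V ⊆ W) : IsDoubleSchubertOn V S where
  normalization w hw := hS.normalization w (hVW hw)
  recursion w hw := hS.recursion w (hVW hw)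

theorem IsDoubleSchubertOn.eqOn {W : Set SInf} {S T : SInf → Poly}
    (hS : IsDoubleSchubertOn W S) (hT : IsDoubleSchubertOn W T)
    (hW : ∀ w ∈ W, ∀ i, IsDescent w i → w * simpleTransposition i ∈ W) : Set.EqOn S T W := by
  intro w hw
  induction hl : length w using Nat.strong_induction_on generalizing w with
  | _ l ih =>
  subst hl
  have hinvariant (i : ℕ) : act (simpleTransposition i) (S w - T w) = S w - T w := by
    refine act_sub_eq_self_of_dividedDifference_eq ?_
    rw [hS.recursion w hw, hT.recursion w hw]
    split_ifs with h
    · exact ih _ (length_mul_simpleTransposition_lt_iff.2 h) (hW w hw i h) rfl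
    · rfl
  have hzero : evalAtT (S w - T w) = 0 := by
    have hST := (hS.normalization w hw).trans (hT.normalization w hw).symm
    simpa only [evalAtT, map_sub, sub_eq_zero] using hST
  rw [← sub_eq_zero, ← evalAtT_eq_self_of_act_eq_self hinvariant, hzero]

theorem isDoubleSchubertOn_subwordSum_longWord (n : ℕ) :
    IsDoubleSchubertOn (symmetricSubgroup (n + 1))
      fun w => subwordSum (longWord n) (reducedWords w) where
  normalization w _ := evalAtT_subwordSum_longWord n w
  recursion _ hw i := dividedDifference_subwordSum_longWord hw i

theorem IsDoubleSchubertOn.eq_subwordSum {n : ℕ} {S : SInf → Poly}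
    (hS : IsDoubleSchubertOn (symmetricSubgroup (n + 1)) S) {w : SInf}
    (hw : w ∈ symmetricSubgroup (n + 1)) :
    S w = subwordSum (longWord n) (reducedWords w) :=
  hS.eqOn (isDoubleSchubertOn_subwordSum_longWord n)
    (fun _ hv _ h => h.mul_mem_symmetricSubgroup hv) hw

theorem IsDoubleSchubertFamily.isDoubleSchubertOn {S : SInf → Poly}
    (hS : IsDoubleSchubertFamily S) (W : Set SInf) : IsDoubleSchubertOn W S where
  normalization w _ := hS.normalization w
  recursion w _ i := by
    simp only [hS.recursion, length_mul_simpleTransposition_lt_iff]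

/-- The double Schubert polynomial `𝔖_w(x;t)`, constructed as the subword sum over the long word
for some `n` with `w ∈ S_{n+1}`; by `doubleSchubert_eq_subwordSum` the choice of `n` is
immaterial. -/
noncomputable def doubleSchubert (w : SInf) : Poly :=
  subwordSum (longWord (exists_mem_symmetricSubgroup w).choose) (reducedWords w)

theorem doubleSchubert_eq_subwordSum {n : ℕ} {w : SInf} (hw : w ∈ symmetricSubgroup (n + 1)) :
    doubleSchubert w = subwordSum (longWord n) (reducedWords w) := by
  have stable {m n : ℕ} (hmn : m ≤ n) {w : SInf} (hw : w ∈ symmetricSubgroup (m + 1)) :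
      subwordSum (longWord n) (reducedWords w) = subwordSum (longWord m) (reducedWords w) :=
    ((isDoubleSchubertOn_subwordSum_longWord n).mono
      (symmetricSubgroup_mono (Nat.succ_le_succ hmn))).eq_subwordSum hw
  rcases le_total n (exists_mem_symmetricSubgroup w).choose with h | h
  · exact stable h hw
  · exact (stable h (exists_mem_symmetricSubgroup w).choose_spec).symm

theorem isDoubleSchubertFamily_doubleSchubert : IsDoubleSchubertFamily doubleSchubert where
  homogeneous w := ⟨length w, isHomogeneous_subwordSum _ fun _ hl => hl.2⟩
  normalization w := evalAtT_subwordSum_longWord _ w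
  recursion w i := by
    obtain ⟨n, hw⟩ := exists_mem_symmetricSubgroup w
    rw [doubleSchubert_eq_subwordSum hw, dividedDifference_subwordSum_longWord hw]
    simp only [length_mul_simpleTransposition_lt_iff]
    split_ifs with h
    · rw [doubleSchubert_eq_subwordSum (h.mul_mem_symmetricSubgroup hw)]
    · rfl

theorem IsDoubleSchubertFamily.eq_doubleSchubert {S : SInf → Poly}
    (hS : IsDoubleSchubertFamily S) : S = doubleSchubert :=
  (Set.eqOn_univ _ _).1 <| (hS.isDoubleSchubertOn Set.univ).eqOn
    (isDoubleSchubertFamily_doubleSchubert.isDoubleSchubertOn Set.univ) fun _ _ _ _ => trivial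

end DoubleSchubert

end VineModel

/-- There is exactly one family with the properties characterizing double Schubert polynomials,
and its member at `w ∈ S_{n+1}` is the weighted sum over the subwords of the long word that are
reduced words of `w`. -/
theorem theorem6p1 :
    (∃! S : VineModel.SInf → VineModel.Poly, VineModel.IsDoubleSchubertFamily S) ∧
    ∀ S : VineModel.SInf → VineModel.Poly, VineModel.IsDoubleSchubertFamily S →
      ∀ (n : ℕ) (w : VineModel.SInf), w ∈ VineModel.symmetricSubgroup (n + 1) →
        S w = VineModel.subwordSum (VineModel.longWord n) (VineModel.reducedWords w) := by
  refine ⟨⟨_, VineModel.isDoubleSchubertFamily_doubleSchubert, fun S hS => hS.eq_doubleSchubert⟩,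
    fun S hS n w hw => ?_⟩
  rw [hS.eq_doubleSchubert, VineModel.doubleSchubert_eq_subwordSum hw]
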